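/- A \emph{contact algebra} is a Boolean algebra $B$ (the case $0=1$ is allowed, complement $a^*$) with a binary relation $\rho$ such that: $a\rho a$ for $a\neq 0$; $a\rho b$ implies $a\neq 0\neq b$; $a\rho b$ implies $b\rho a$; $a\rho(b\vee c)$ iff $a\rho b$ or $a\rho c$. Write $a\ll_\rho b$ if not $a\rho b^*$. A \emph{local contact algebra} $(B,\rho,\mathbb B)$ is a contact algebra $(B,\rho)$ with a subset $\mathbb B\subseteq B$ (the bounded elements) that contains $0$, is downward closed and closed under binary joins, and satisfies: if $a\in\mathbb B$ and $a\ll_\rho c$, then $a\ll_\rho b\ll_\rho c$ for some $b\in\mathbb B$; if $a\rho b$, then $a\rho(c\wedge b)$ for some $c\in\mathbb B$; if $a\neq0$, then there is $b\in\mathbb B\setminus\{0\}$ with $b\ll_\rho a$. An \emph{MVD-algebra} $(B,\le,\ll)$ is a Boolean algebra $(B,\le)$ with a binary relation $\ll$ such that: $a\ll b$ implies $a\le b$; $0\ll0$; $a\le b\ll c\le t$ implies $a\ll t$; $a\ll c$ and $b\ll c$ imply $a\vee b\ll c$; $a\ll c$ implies $a\ll b\ll c$ for some $b$; if $a\ne0$,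 then there is $b\neq0$ with $b\ll a$; $a\ll b$ and $a\ll c$ imply $a\ll b\wedge c$; if $a\ll1$ and $b^*\ll a^*$, then $a\ll b$. Either kind of algebra is \emph{complete} if $B$ is a complete Boolean algebra. For a complete Boolean homomorphism $\varphi:A\to B$ between complete Boolean algebras (one preserving all joins and meets), $\varphi_\Lambda:B\to A$ denotes its lower adjoint: $\varphi_\Lambda(b)\le a$ iff $b\le\varphi(a)$. Consider the following three categories, with the usual composition of functions. $\mathbf{SAL}$: objects are the complete local contact algebras; morphisms $(A,\rho,\mathbb B)\to(B,\eta,\mathbb B')$ are the complete Boolean homomorphisms $\varphi:A\to B$ such that (L1) $\varphi(a)\eta\varphi(b)$ implies $a\rho b$; (L2) $b\in\mathbb B'$ implies $\varphi_\Lambda(b)\in\mathbb B$; (L3) $a\in\mathbb B$ implies $\varphi(a)\in\mathbb B'$. $\mathbf{IA}$: objects are the complete MVD-algebras; morphisms $(B,\le,\ll)\to(B',\le',\ll')$ are the complete Boolean homomorphisms $\varphi:B\to B'$ such that (ES1) $a\ll b$ implies $\varphi(a)\ll'\varphi(b)$; (S2) $b\ll'1$ implies $\varphi_\Lambda(b)\ll1$;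 (S3) $a\ll1$ implies $\varphi(a)\ll'1$. $\mathbf{SLC}$: objects are the locally compact Hausdorff spaces; morphisms are the skeletal perfect maps. Here a map $f:X\to Y$ is \emph{perfect} if it is continuous and closed (not necessarily onto) with compact point inverses, and \emph{skeletal} if $\operatorname{int}(\operatorname{cl}(f(U)))\neq\emptyset$ for every non-empty open $U\subseteq X$. Theorem. The categories $\mathbf{SAL}$ and $\mathbf{IA}$ are isomorphic, and the categories $\mathbf{SLC}$ and $\mathbf{IA}$ are dually equivalent. Moreover, a perfect map $f:X\to Y$ between locally compact Hausdorff spaces is skeletal if and only if it is quasi-open (that is, continuous with $\operatorname{int}(f(U))\ne\emptyset$ for every non-empty open $U\subseteq X$), so the morphisms of $\mathbf{SLC}$ are precisely the quasi-open perfect maps. -/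

import Mathlib

universe u

/-! ### Lower adjoints of complete Boolean homomorphisms

A complete Boolean homomorphism between complete Boolean algebras is a map preserving all joins and
all meets (hence also `⊥`, `⊤` and complements), that is, a `CompleteLatticeHom`. -/

section LowerAdjoint

variable {A B : Type*} [CompleteLattice A] [CompleteLattice B]

/-- The lower adjoint `φ_Λ` of a complete homomorphism `φ`. -/
def lowerAdj (φ : CompleteLatticeHom A B) (b : B) : A := sInf {a | b ≤ φ a}

/-- `φ_Λ` is characterised by `φ_Λ b ≤ a ↔ b ≤ φ a`. -/
theorem lowerAdj_gc (φ : CompleteLatticeHom A B) : GaloisConnection (lowerAdj φ) φ := by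
  intro b a
  constructor
  · intro h
    refine le_trans ?_ (OrderHomClass.mono φ h)
    rw [lowerAdj, map_sInf]
    exact le_sInf (by rintro _ ⟨x, hx, rfl⟩; exact hx)
  · intro h
    exact sInf_le h

theorem lowerAdj_id (b : B) : lowerAdj (CompleteLatticeHom.id B) b = b :=
  eq_of_forall_ge_iff fun c => lowerAdj_gc (CompleteLatticeHom.id B) b c

theorem lowerAdj_comp {C : Type*} [CompleteLattice C]
    (ψ : CompleteLatticeHom B C) (φ : CompleteLatticeHom A B) (c : C) :
    lowerAdj (ψ.comp φ) c = lowerAdj φ (lowerAdj ψ c) :=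
  eq_of_forall_ge_iff fun a => by
    rw [lowerAdj_gc (ψ.comp φ) c a, lowerAdj_gc φ, lowerAdj_gc ψ]; rfl

end LowerAdjoint

/-! ### Contact algebras, local contact algebras and MVD-algebras -/

section Algebras

variable {B : Type*} [BooleanAlgebra B]

/-- `C` is a contact relation on the Boolean algebra `B`. -/
structure IsContactRel (C : B → B → Prop) : Prop where
  c1 : ∀ a, a ≠ ⊥ → C a a
  c2 : ∀ a b, C a b → a ≠ ⊥ ∧ b ≠ ⊥
  c3 : ∀ a b, C a b → C b a
  c4 : ∀ a b c, C a (b ⊔ c) ↔ C a b ∨ C a c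

/-- Non-tangential inclusion `a ≪_C b`. -/
def NonTangential (C : B → B → Prop) (a b : B) : Prop := ¬ C a bᶜ

/-- `(B, ρ, 𝔹)` is a local contact algebra; the elements of `𝔹` are the bounded elements. -/
structure IsLocalContact (ρ : B → B → Prop) (𝔹 : Set B) : Prop extends IsContactRel ρ where
  bb1 : ⊥ ∈ 𝔹
  bb2 : ∀ a b, a ≤ b → b ∈ 𝔹 → a ∈ 𝔹
  bb3 : ∀ a b, a ∈ 𝔹 → b ∈ 𝔹 → a ⊔ b ∈ 𝔹
  bc1 : ∀ a c, a ∈ 𝔹 → NonTangential ρ a c →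
    ∃ b ∈ 𝔹, NonTangential ρ a b ∧ NonTangential ρ b c
  bc2 : ∀ a b, ρ a b → ∃ c ∈ 𝔹, ρ a (c ⊓ b)
  bc3 : ∀ a, a ≠ ⊥ → ∃ b ∈ 𝔹, b ≠ ⊥ ∧ NonTangential ρ b a

/-- `(B, ≤, ll)` is an MVD-algebra. -/
structure IsMVD (ll : B → B → Prop) : Prop where
  ll1 : ∀ a b, ll a b → a ≤ b
  ll2 : ll ⊥ ⊥
  ll3 : ∀ a b c t, a ≤ b → ll b c → c ≤ t → ll a t
  ll4 : ∀ a b c, ll a c → ll b c → ll (a ⊔ b) c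
  ll5 : ∀ a c, ll a c → ∃ b, ll a b ∧ ll b c
  ll6 : ∀ a, a ≠ ⊥ → ∃ b, b ≠ ⊥ ∧ ll b a
  ll4' : ∀ a b c, ll a b → ll a c → ll a (b ⊓ c)
  mvd : ∀ a b, ll a ⊤ → ll bᶜ aᶜ → ll a b

end Algebras

/-! ### The category `SAL` -/

/-- Objects of `SAL` (and of `SKAL`): complete local contact algebras. -/
structure SAL : Type (u + 1) where
  carrier : Type u
  [alg : CompleteBooleanAlgebra carrier]
  /-- the contact relation -/
  rho : carrier → carrier → Prop
  /-- the set of bounded elements -/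
  bdd : Set carrier
  isLocalContact : IsLocalContact rho bdd

attribute [instance] SAL.alg

/-- `φ` is a morphism of the category `SKAL`. -/
structure IsSKALMorphism (X Y : SAL.{u}) (φ : CompleteLatticeHom X.carrier Y.carrier) : Prop where
  l1 : ∀ a b, Y.rho (φ a) (φ b) → X.rho a b
  l2 : ∀ b, b ∈ Y.bdd → lowerAdj φ b ∈ X.bdd

/-- `φ` is a morphism of `SAL`: a `SKAL`-morphism mapping bounded elements to bounded elements. -/
structure IsSALMorphism (X Y : SAL.{u}) (φ : CompleteLatticeHom X.carrier Y.carrier) : Prop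
    extends IsSKALMorphism X Y φ where
  l3 : ∀ a, a ∈ X.bdd → φ a ∈ Y.bdd

/-- Morphisms of `SAL`, composed as functions. -/
@[ext]
structure SAL.Hom (X Y : SAL.{u}) : Type u where
  toHom : CompleteLatticeHom X.carrier Y.carrier
  prop : IsSALMorphism X Y toHom

instance SAL.category : CategoryTheory.Category.{u} SAL.{u} where
  Hom := SAL.Hom
  id X := ⟨CompleteLatticeHom.id X.carrier,
    { l1 := fun _ _ h => h
      l2 := fun b h => by rw [lowerAdj_id]; exact h
      l3 := fun _ h => h }⟩
  comp f g := ⟨g.toHom.comp f.toHom,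
    { l1 := fun a b h => f.prop.l1 a b (g.prop.l1 _ _ h)
      l2 := fun b h => by rw [lowerAdj_comp]; exact f.prop.l2 _ (g.prop.l2 b h)
      l3 := fun a h => g.prop.l3 _ (f.prop.l3 a h) }⟩

/-! ### The category `IA` -/

/-- Objects of `IA`: complete MVD-algebras. -/
structure IA : Type (u + 1) where
  carrier : Type u
  [alg : CompleteBooleanAlgebra carrier]
  /-- the relation of interior parthood -/
  ll : carrier → carrier → Prop
  isMVD : IsMVD ll

attribute [instance] IA.alg

/-- `φ` is a morphism of `IA`. -/
structure IsIAMorphism (X Y : IA.{u}) (φ : CompleteLatticeHom X.carrier Y.carrier) : Prop where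
  es1 : ∀ a b, X.ll a b → Y.ll (φ a) (φ b)
  s2 : ∀ b, Y.ll b ⊤ → X.ll (lowerAdj φ b) ⊤
  s3 : ∀ a, X.ll a ⊤ → Y.ll (φ a) ⊤

/-- Morphisms of `IA`, composed as functions. -/
@[ext]
structure IA.Hom (X Y : IA.{u}) : Type u where
  toHom : CompleteLatticeHom X.carrier Y.carrier
  prop : IsIAMorphism X Y toHom

instance IA.category : CategoryTheory.Category.{u} IA.{u} where
  Hom := IA.Hom
  id X := ⟨CompleteLatticeHom.id X.carrier,
    { es1 := fun _ _ h => h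
      s2 := fun b h => by rw [lowerAdj_id]; exact h
      s3 := fun _ h => h }⟩
  comp f g := ⟨g.toHom.comp f.toHom,
    { es1 := fun a b h => g.prop.es1 _ _ (f.prop.es1 a b h)
      s2 := fun b h => by rw [lowerAdj_comp]; exact f.prop.s2 _ (g.prop.s2 b h)
      s3 := fun a h => g.prop.s3 _ (f.prop.s3 a h) }⟩

/-! ### Skeletal perfect maps of locally compact Hausdorff spaces -/

section Maps

variable {X Y Z : Type*} [TopologicalSpace X] [TopologicalSpace Y] [TopologicalSpace Z]

/-- A perfect map: a continuous closed map (not necessarily onto) with compact fibres. -/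
structure IsPerfectMap (f : X → Y) : Prop where
  continuous : Continuous f
  isClosedMap : IsClosedMap f
  isCompact_fiber : ∀ y, IsCompact (f ⁻¹' {y})

/-- A skeletal function. -/
def IsSkeletal (f : X → Y) : Prop :=
  ∀ U : Set X, IsOpen U → U.Nonempty → (interior (closure (f '' U))).Nonempty

/-- A quasi-open map. -/
structure IsQuasiOpen (f : X → Y) : Prop where
  continuous : Continuous f
  interior_nonempty : ∀ U : Set X, IsOpen U → U.Nonempty → (interior (f '' U)).Nonempty

theorem isPerfectMap_iff (f : X → Y) : IsPerfectMap f ↔ IsProperMap f := by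
  rw [isProperMap_iff_isClosedMap_and_compact_fibers]
  exact ⟨fun h => ⟨h.1, h.2, h.3⟩, fun h => ⟨h.1, h.2.1, h.2.2⟩⟩

theorem IsPerfectMap.id : IsPerfectMap (id : X → X) :=
  (isPerfectMap_iff _).2 isProperMap_id

theorem IsPerfectMap.comp {g : Y → Z} {f : X → Y} (hg : IsPerfectMap g) (hf : IsPerfectMap f) :
    IsPerfectMap (g ∘ f) :=
  (isPerfectMap_iff _).2 (((isPerfectMap_iff g).1 hg).comp ((isPerfectMap_iff f).1 hf))

theorem IsSkeletal.id : IsSkeletal (id : X → X) := fun U hU hne => by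
  rw [Set.image_id]
  exact hne.mono (interior_maximal subset_closure hU)

theorem IsSkeletal.comp {g : Y → Z} {f : X → Y} (hg : IsSkeletal g) (hgc : Continuous g)
    (hf : IsSkeletal f) : IsSkeletal (g ∘ f) := fun U hU hne => by
  refine (hg _ isOpen_interior (hf U hU hne)).mono (interior_mono ?_)
  refine closure_minimal ?_ isClosed_closure
  rw [Set.image_comp]
  exact (Set.image_mono interior_subset).trans (image_closure_subset_closure_image hgc)

end Maps

/-- Objects of `SLC`: locally compact Hausdorff spaces. -/
structure SLC : Type (u + 1) where
  carrier : Type u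
  [top : TopologicalSpace carrier]
  [locallyCompact : LocallyCompactSpace carrier]
  [t2 : T2Space carrier]

attribute [instance] SLC.top SLC.locallyCompact SLC.t2

/-- Morphisms of `SLC`: skeletal perfect maps. -/
@[ext]
structure SLC.Hom (X Y : SLC.{u}) : Type u where
  toFun : X.carrier → Y.carrier
  isPerfect : IsPerfectMap toFun
  isSkeletal : IsSkeletal toFun

instance SLC.category : CategoryTheory.Category.{u} SLC.{u} where
  Hom := SLC.Hom
  id X := ⟨id, IsPerfectMap.id, IsSkeletal.id⟩
  comp f g := ⟨g.toFun ∘ f.toFun, g.isPerfect.comp f.isPerfect,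
    g.isSkeletal.comp g.isPerfect.continuous f.isSkeletal⟩

/-! In a local contact algebra, contact is determined by its restriction to bounded elements. Hence
the relation "`a` is bounded and `a ≪_ρ b`" loses nothing: the bounded elements are those with `b ≪
1`, and `a ρ b` holds iff `c ∧ a ≪ b*` fails for some bounded `c`. These passages are mutually
inverse and have the same morphisms.

For the duality, a space goes to its regular open sets, with `U ≪ V` when `cl U` is compact and
inside `V`, and a map `f` goes to `V ↦ int cl f⁻¹(V)`. Skeletality makes preimages of dense open
sets dense, and so makes this a complete homomorphism. Conversely, compactness extracts from a
morphism `φ` a point map `f` with `f⁻¹(V) ⊆ φ(V) ⊆ f⁻¹(cl V)`. This sandwich gives continuity, (S3)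
gives properness, and preservation of joins gives skeletality and recovers `φ`. Finally, a complete
MVD-algebra is the algebra of regular open sets of its space of points (`regBasicIso`, `ll_iff`). -/

/-! ### The isomorphism of `SAL` and `IA` -/

section Relations

variable {B : Type*} [BooleanAlgebra B]

/-- The relation of interior parthood of a local contact algebra. -/
def boundedNonTangential (ρ : B → B → Prop) (𝔹 : Set B) (a b : B) : Prop :=
  a ∈ 𝔹 ∧ NonTangential ρ a b

/-- The contact relation of an MVD-algebra. -/
def contactOfMVD (ll : B → B → Prop) (a b : B) : Prop :=
  ∃ c, ll c ⊤ ∧ ¬ ll (c ⊓ a) bᶜ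

theorem IsContactRel.mono_right {ρ : B → B → Prop} (h : IsContactRel ρ) {a b c : B}
    (hab : ρ a b) (hbc : b ≤ c) : ρ a c := by
  rw [← sup_eq_right.2 hbc]
  exact (h.c4 _ _ _).2 (Or.inl hab)

theorem IsContactRel.mono {ρ : B → B → Prop} (h : IsContactRel ρ) {a b c d : B}
    (hab : ρ a b) (hac : a ≤ c) (hbd : b ≤ d) : ρ c d :=
  h.mono_right (h.c3 _ _ (h.mono_right (h.c3 _ _ hab) hac)) hbd

theorem NonTangential.top {ρ : B → B → Prop} (h : IsContactRel ρ) (a : B) :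
    NonTangential ρ a ⊤ := fun hc => (h.c2 _ _ hc).2 compl_top

theorem NonTangential.le {ρ : B → B → Prop} (h : IsContactRel ρ) {a b : B}
    (hab : NonTangential ρ a b) : a ≤ b := by
  by_contra hne
  have hne' : a ⊓ bᶜ ≠ ⊥ := fun h0 => hne (by
    rw [← compl_compl b]; exact le_compl_iff_disjoint_right.2 (disjoint_iff.2 h0))
  exact hab (h.mono (h.c1 _ hne') inf_le_left inf_le_right)

theorem IsLocalContact.isMVD {ρ : B → B → Prop} {𝔹 : Set B} (h : IsLocalContact ρ 𝔹) :
    IsMVD (boundedNonTangential ρ 𝔹) where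
  ll1 _ _ hab := NonTangential.le h.toIsContactRel hab.2
  ll2 := ⟨h.bb1, fun hc => (h.c2 _ _ hc).1 rfl⟩
  ll3 _ _ _ _ hab hbc hct := ⟨h.bb2 _ _ hab hbc.1,
    fun hr => hbc.2 (h.mono hr hab (compl_le_compl hct))⟩
  ll4 a b c hac hbc := ⟨h.bb3 _ _ hac.1 hbc.1, fun hr =>
    ((h.c4 _ _ _).1 (h.c3 _ _ hr)).elim (fun h' => hac.2 (h.c3 _ _ h'))
      (fun h' => hbc.2 (h.c3 _ _ h'))⟩
  ll5 a c hac := by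
    obtain ⟨b, hb, hab, hbc⟩ := h.bc1 a c hac.1 hac.2
    exact ⟨b, ⟨hac.1, hab⟩, ⟨hb, hbc⟩⟩
  ll6 a ha := by
    obtain ⟨b, hb, hb0, hba⟩ := h.bc3 a ha
    exact ⟨b, hb0, hb, hba⟩
  ll4' a b c hab hac := ⟨hab.1, fun hr => by
    rw [compl_inf] at hr
    exact ((h.c4 _ _ _).1 hr).elim hab.2 hac.2⟩
  -- This axiom encodes the symmetry of `ρ`.
  mvd a b ha hba := ⟨ha.1, fun hr => hba.2 (by rw [compl_compl]; exact h.c3 _ _ hr)⟩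

theorem IsMVD.mono {ll : B → B → Prop} (h : IsMVD ll) {a b c d : B} (hbc : ll b c)
    (hab : a ≤ b) (hcd : c ≤ d) : ll a d := h.ll3 _ _ _ _ hab hbc hcd

theorem IsMVD.bot_ll {ll : B → B → Prop} (h : IsMVD ll) (a : B) : ll ⊥ a :=
  h.mono h.ll2 le_rfl bot_le

theorem IsMVD.bounded {ll : B → B → Prop} (h : IsMVD ll) {a b : B} (hab : ll a b) : ll a ⊤ :=
  h.mono hab le_rfl le_top

theorem IsMVD.inf_ll_inf {ll : B → B → Prop} (h : IsMVD ll) {a b c d : B}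
    (hac : ll a c) (hbd : ll b d) : ll (a ⊓ b) (c ⊓ d) :=
  h.ll4' _ _ _ (h.mono hac inf_le_left le_rfl) (h.mono hbd inf_le_right le_rfl)

/-- A bounded element disjoint from `b` is a strong part of `aᶜ` when `a ≪ b`. -/
theorem IsMVD.ll_compl {ll : B → B → Prop} (h : IsMVD ll) {a b c : B}
    (hab : ll a b) (hc : ll c ⊤) (hcb : c ≤ bᶜ) : ll c aᶜ :=
  h.mvd _ _ hc (by rw [compl_compl]; exact h.mono hab le_rfl (le_compl_comm.1 hcb))

theorem not_contactOfMVD {ll : B → B → Prop} {a b : B} :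
    ¬ contactOfMVD ll a b ↔ ∀ c, ll c ⊤ → ll (c ⊓ a) bᶜ := by
  simp [contactOfMVD]

theorem nonTangential_contactOfMVD {ll : B → B → Prop} {a b : B} :
    NonTangential (contactOfMVD ll) a b ↔ ∀ c, ll c ⊤ → ll (c ⊓ a) b := by
  rw [NonTangential, not_contactOfMVD, compl_compl]

theorem IsMVD.nonTangential_of_ll {ll : B → B → Prop} (h : IsMVD ll) {a b : B} (hab : ll a b) :
    NonTangential (contactOfMVD ll) a b :=
  nonTangential_contactOfMVD.2 fun _ _ => h.mono hab inf_le_right le_rfl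

theorem IsMVD.ll_of_nonTangential {ll : B → B → Prop} {a b : B} (ha : ll a ⊤)
    (hab : NonTangential (contactOfMVD ll) a b) : ll a b := by
  simpa using nonTangential_contactOfMVD.1 hab a ha

/-- For bounded `c` choose `c ≪ d ≪ 1`. From `d ∧ b ≪ a*` the axiom `mvd` gives `c ∧ a ≪ (d ∧ b)*`;
as also `c ∧ a ≪ d`, it follows that `c ∧ a ≪ d ∧ b* ≤ b*`. -/
theorem IsMVD.contactOfMVD_symm {ll : B → B → Prop} (h : IsMVD ll) {a b : B}
    (hab : contactOfMVD ll a b) : contactOfMVD ll b a := by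
  by_contra hba
  rw [not_contactOfMVD] at hba
  refine not_contactOfMVD.2 (fun c hc => ?_) hab
  obtain ⟨d, hcd, hd⟩ := h.ll5 _ _ hc
  have h1 : ll (c ⊓ a) (d ⊓ b)ᶜ := by
    refine h.mvd _ _ (h.mono hc inf_le_left le_rfl) ?_
    rw [compl_compl]
    exact h.mono (hba d hd) le_rfl (compl_le_compl inf_le_right)
  refine h.mono (h.ll4' _ _ _ (h.mono hcd inf_le_left le_rfl) h1) le_rfl ?_
  rw [compl_inf, inf_sup_left, inf_compl_eq_bot, bot_sup_eq]
  exact inf_le_right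

theorem IsMVD.isLocalContact {ll : B → B → Prop} (h : IsMVD ll) :
    IsLocalContact (contactOfMVD ll) {b | ll b ⊤} where
  c1 a ha := by
    obtain ⟨b, hb, hba⟩ := h.ll6 a ha
    refine ⟨b, h.bounded hba, fun hc => hb ?_⟩
    have hab := h.ll1 _ _ hba
    rw [inf_eq_left.2 hab] at hc
    exact disjoint_self.1 ((le_compl_iff_disjoint_right.1 (h.ll1 _ _ hc)).mono_right hab)
  c2 a b := by
    rintro ⟨c, hc, hab⟩
    constructor
    · rintro rfl
      exact hab (by simpa using h.bot_ll _)
    · rintro rfl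
      exact hab (by simpa using h.mono hc inf_le_left le_rfl)
  c3 _ _ := h.contactOfMVD_symm
  c4 a b c := by
    rw [← not_iff_not, not_or, not_contactOfMVD, not_contactOfMVD, not_contactOfMVD,
      ← forall_and]
    refine forall_congr' fun d => ?_
    rw [← imp_and]
    refine imp_congr_right fun _ => ?_
    rw [compl_sup]
    exact ⟨fun h' => ⟨h.mono h' le_rfl inf_le_left, h.mono h' le_rfl inf_le_right⟩,
      fun h' => h.ll4' _ _ _ h'.1 h'.2⟩
  bb1 := h.bot_ll _
  bb2 _ _ hab hb := h.mono hb hab le_rfl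
  bb3 _ _ ha hb := h.ll4 _ _ _ ha hb
  bc1 a c ha hac := by
    obtain ⟨b, hab, hbc⟩ := h.ll5 _ _ (IsMVD.ll_of_nonTangential ha hac)
    exact ⟨b, h.bounded hbc, h.nonTangential_of_ll hab, h.nonTangential_of_ll hbc⟩
  bc2 a b hab := by
    -- The definition localises the first argument; symmetry moves the bounded witness to the
    -- second.
    obtain ⟨c, hc, hcb⟩ := h.contactOfMVD_symm hab
    refine ⟨c, hc, h.contactOfMVD_symm ⟨c, hc, ?_⟩⟩
    rwa [← inf_assoc, inf_idem]
  bc3 a ha := by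
    obtain ⟨b, hb, hba⟩ := h.ll6 a ha
    exact ⟨b, h.bounded hba, hb, h.nonTangential_of_ll hba⟩

theorem IsLocalContact.boundedNonTangential_top {ρ : B → B → Prop} {𝔹 : Set B}
    (h : IsLocalContact ρ 𝔹) {b : B} : boundedNonTangential ρ 𝔹 b ⊤ ↔ b ∈ 𝔹 :=
  ⟨fun hb => hb.1, fun hb => ⟨hb, NonTangential.top h.toIsContactRel b⟩⟩

/-- Axiom `bc2` says that every contact is witnessed on a bounded part; the other inclusion is
monotonicity. -/
theorem IsLocalContact.contactOfMVD_eq {ρ : B → B → Prop} {𝔹 : Set B}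
    (h : IsLocalContact ρ 𝔹) : contactOfMVD (boundedNonTangential ρ 𝔹) = ρ := by
  ext a b
  constructor
  · rintro ⟨c, hc, hab⟩
    by_contra hr
    refine hab ⟨h.bb2 _ _ inf_le_left hc.1, fun h' => hr ?_⟩
    rw [compl_compl] at h'
    exact h.mono h' inf_le_right le_rfl
  · intro hab
    obtain ⟨c, hc, hcb⟩ := h.bc2 _ _ (h.c3 _ _ hab)
    refine ⟨c, h.boundedNonTangential_top.2 hc, fun h' => h'.2 ?_⟩
    rw [compl_compl]
    exact h.c3 _ _ hcb

theorem IsMVD.boundedNonTangential_eq {ll : B → B → Prop} (h : IsMVD ll) :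
    boundedNonTangential (contactOfMVD ll) {b | ll b ⊤} = ll := by
  ext a b
  exact ⟨fun hab => IsMVD.ll_of_nonTangential hab.1 hab.2,
    fun hab => ⟨h.bounded hab, h.nonTangential_of_ll hab⟩⟩

end Relations

/-! ### The mutually inverse functors -/

/-- The complete MVD-algebra of a complete local contact algebra. -/
def SAL.toIA (X : SAL.{u}) : IA.{u} where
  carrier := X.carrier
  ll := boundedNonTangential X.rho X.bdd
  isMVD := X.isLocalContact.isMVD

/-- The complete local contact algebra of a complete MVD-algebra. -/
def IA.toSAL (X : IA.{u}) : SAL.{u} where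
  carrier := X.carrier
  rho := contactOfMVD X.ll
  bdd := {b | X.ll b ⊤}
  isLocalContact := X.isMVD.isLocalContact

theorem SAL.mk_congr {B : Type u} [CompleteBooleanAlgebra B] {ρ ρ' : B → B → Prop} {𝔹 𝔹' : Set B}
    (h : IsLocalContact ρ 𝔹) (h' : IsLocalContact ρ' 𝔹') (hρ : ρ = ρ') (h𝔹 : 𝔹 = 𝔹') :
    SAL.mk B ρ 𝔹 h = SAL.mk B ρ' 𝔹' h' := by
  subst hρ h𝔹; rfl

/-- A round trip changes the relations of an object only up to propositional equality, so morphisms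
must be compared heterogeneously. -/
theorem SAL.Hom.mk_heq {A B : Type u} [CompleteBooleanAlgebra A] [CompleteBooleanAlgebra B]
    {α α' : A → A → Prop} {𝔸 𝔸' : Set A} {ρ ρ' : B → B → Prop} {𝔹 𝔹' : Set B}
    {g : IsLocalContact α 𝔸} {g' : IsLocalContact α' 𝔸'}
    {h : IsLocalContact ρ 𝔹} {h' : IsLocalContact ρ' 𝔹'} (φ : CompleteLatticeHom A B)
    (p : IsSALMorphism (SAL.mk A α 𝔸 g) (SAL.mk B ρ 𝔹 h) φ)
    (p' : IsSALMorphism (SAL.mk A α' 𝔸' g') (SAL.mk B ρ' 𝔹' h') φ)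
    (hα : α = α') (h𝔸 : 𝔸 = 𝔸') (hρ : ρ = ρ') (h𝔹 : 𝔹 = 𝔹') :
    HEq (⟨φ, p⟩ : SAL.Hom (SAL.mk A α 𝔸 g) (SAL.mk B ρ 𝔹 h))
      (⟨φ, p'⟩ : SAL.Hom (SAL.mk A α' 𝔸' g') (SAL.mk B ρ' 𝔹' h')) := by
  subst hα h𝔸 hρ h𝔹; rfl

theorem IA.mk_congr {B : Type u} [CompleteBooleanAlgebra B] {ll ll' : B → B → Prop}
    (h : IsMVD ll) (h' : IsMVD ll') (hll : ll = ll') : IA.mk B ll h = IA.mk B ll' h' := by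
  subst hll; rfl

theorem IA.Hom.mk_heq {A B : Type u} [CompleteBooleanAlgebra A] [CompleteBooleanAlgebra B]
    {α α' : A → A → Prop} {β β' : B → B → Prop} {g : IsMVD α} {g' : IsMVD α'}
    {h : IsMVD β} {h' : IsMVD β'} (φ : CompleteLatticeHom A B)
    (p : IsIAMorphism (IA.mk A α g) (IA.mk B β h) φ)
    (p' : IsIAMorphism (IA.mk A α' g') (IA.mk B β' h') φ) (hα : α = α') (hβ : β = β') :
    HEq (⟨φ, p⟩ : IA.Hom (IA.mk A α g) (IA.mk B β h))
      (⟨φ, p'⟩ : IA.Hom (IA.mk A α' g') (IA.mk B β' h')) := by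
  subst hα hβ; rfl

theorem CompleteLatticeHom.map_compl_eq {A B : Type*} [CompleteBooleanAlgebra A]
    [CompleteBooleanAlgebra B] (φ : CompleteLatticeHom A B) (a : A) : φ aᶜ = (φ a)ᶜ := by
  refine (IsCompl.compl_eq ⟨?_, ?_⟩).symm
  · rw [disjoint_iff, ← map_inf, inf_compl_eq_bot, map_bot]
  · rw [codisjoint_iff, ← map_sup, sup_compl_eq_top, map_top]

theorem IsSALMorphism.isIAMorphism {X Y : SAL.{u}} {φ : CompleteLatticeHom X.carrier Y.carrier}
    (h : IsSALMorphism X Y φ) : IsIAMorphism X.toIA Y.toIA φ where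
  es1 (_ b : X.carrier) hab :=
    ⟨h.l3 _ hab.1, fun hr => hab.2 (h.l1 _ _ (φ.map_compl_eq b ▸ hr))⟩
  s2 b hb := X.isLocalContact.boundedNonTangential_top.2 (h.l2 b hb.1)
  s3 a ha := Y.isLocalContact.boundedNonTangential_top.2 (h.l3 a ha.1)

/-- For (L1), non-contact of `a` and `b` is used at `φ_Λ d`, bounded by (S2); (ES1) transports it,
and `d ≤ φ (φ_Λ d)`. -/
theorem IsIAMorphism.isSALMorphism {X Y : IA.{u}} {φ : CompleteLatticeHom X.carrier Y.carrier}
    (h : IsIAMorphism X Y φ) : IsSALMorphism X.toSAL Y.toSAL φ where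
  l1 (a b : X.carrier) hab := by
    by_contra hr
    refine not_contactOfMVD.2 (fun d hd => ?_) hab
    have h1 := h.es1 _ _ (not_contactOfMVD.1 hr _ (h.s2 d hd))
    rw [φ.map_compl_eq] at h1
    refine Y.isMVD.mono h1 ?_ le_rfl
    rw [map_inf]
    exact inf_le_inf_right _ ((lowerAdj_gc φ).le_u_l d)
  l2 b hb := h.s2 b hb
  l3 a ha := h.s3 a ha

/-- The functor from `SAL` to `IA` which is the identity on underlying algebras and maps. -/
def salToIA : CategoryTheory.Functor SAL.{u} IA.{u} where
  obj := SAL.toIA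
  map f := ⟨f.toHom, f.prop.isIAMorphism⟩

/-- The functor from `IA` to `SAL` which is the identity on underlying algebras and maps. -/
def iaToSAL : CategoryTheory.Functor IA.{u} SAL.{u} where
  obj := IA.toSAL
  map f := ⟨f.toHom, f.prop.isSALMorphism⟩

theorem IsLocalContact.bounded_eq {B : Type*} [BooleanAlgebra B] {ρ : B → B → Prop} {𝔹 : Set B}
    (h : IsLocalContact ρ 𝔹) : {b | boundedNonTangential ρ 𝔹 b ⊤} = 𝔹 :=
  Set.ext fun _ => h.boundedNonTangential_top

theorem salToIA_comp_iaToSAL :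
    salToIA.comp iaToSAL = CategoryTheory.Functor.id SAL.{u} :=
  CategoryTheory.Functor.hext
    (fun X => SAL.mk_congr _ _ X.isLocalContact.contactOfMVD_eq X.isLocalContact.bounded_eq)
    fun X Y f => SAL.Hom.mk_heq f.toHom _ _ X.isLocalContact.contactOfMVD_eq
      X.isLocalContact.bounded_eq Y.isLocalContact.contactOfMVD_eq Y.isLocalContact.bounded_eq

theorem iaToSAL_comp_salToIA :
    iaToSAL.comp salToIA = CategoryTheory.Functor.id IA.{u} :=
  CategoryTheory.Functor.hext (fun X => IA.mk_congr _ _ X.isMVD.boundedNonTangential_eq)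
    fun X Y f => IA.Hom.mk_heq f.toHom _ _ X.isMVD.boundedNonTangential_eq
      Y.isMVD.boundedNonTangential_eq

/-! ### Regular open sets -/

section RegularLattice

variable {α : Type*} [Order.Frame α]

open Heyting.Regular in
instance Heyting.Regular.completeBooleanAlgebra : CompleteBooleanAlgebra (Heyting.Regular α) :=
  { (inferInstance : BooleanAlgebra (Heyting.Regular α)),
    (gi (α := α)).liftCompleteLattice with }

theorem Heyting.Regular.toRegular_le {a : α} {b : Heyting.Regular α} :
    Heyting.Regular.toRegular a ≤ b ↔ a ≤ (b : α) :=
  Heyting.Regular.gi.gc a b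

theorem Heyting.Regular.coe_sSup (s : Set (Heyting.Regular α)) :
    sSup s = Heyting.Regular.toRegular (⨆ a ∈ s, (a : α)) := by
  refine eq_of_forall_ge_iff fun c => ?_
  rw [sSup_le_iff, Heyting.Regular.toRegular_le, iSup₂_le_iff]
  rfl

end RegularLattice

open TopologicalSpace Topology

/-- The complete Boolean algebra of regular open sets. -/
abbrev RegOpens (X : Type*) [TopologicalSpace X] : Type _ := Heyting.Regular (Opens X)

namespace RegOpens

variable {X : Type*} [TopologicalSpace X]

/-- The underlying set of a regular open set. -/
def set (U : RegOpens X) : Set X := (U.val : Set X)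

theorem isOpen (U : RegOpens X) : IsOpen U.set := U.val.isOpen

theorem le_iff {U V : RegOpens X} : U ≤ V ↔ U.set ⊆ V.set := Iff.rfl

theorem set_injective : Function.Injective (set : RegOpens X → Set X) := fun _ _ h =>
  Heyting.Regular.coe_injective (Opens.ext h)

theorem set_inf (U V : RegOpens X) : (U ⊓ V).set = U.set ∩ V.set := rfl

theorem set_top : (⊤ : RegOpens X).set = Set.univ := rfl

theorem set_bot : (⊥ : RegOpens X).set = ∅ := rfl

theorem coe_opens_compl (U : Opens X) : ((Uᶜ : Opens X) : Set X) = (closure (U : Set X))ᶜ := by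
  rw [Opens.coe_compl_eq_interior_compl, interior_compl]

theorem set_compl (U : RegOpens X) : Uᶜ.set = (closure U.set)ᶜ := coe_opens_compl U.val

theorem interior_closure (U : RegOpens X) : interior (closure U.set) = U.set := by
  rw [← compl_compl (interior _), ← closure_compl, ← set_compl, ← set_compl, compl_compl]

/-- The regular open set generated by an open set. -/
def reg (U : Opens X) : RegOpens X := Heyting.Regular.toRegular U

theorem set_reg (U : Opens X) :
    (reg U).set = interior (closure (U : Set X)) := by
  change ((Uᶜᶜ : Opens X) : Set X) = _
  rw [coe_opens_compl, coe_opens_compl, closure_compl, compl_compl]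

theorem subset_reg (U : Opens X) : (U : Set X) ⊆ (reg U).set := by
  rw [set_reg]
  exact interior_maximal subset_closure U.isOpen

theorem reg_le {U : Opens X} {V : RegOpens X} :
    reg U ≤ V ↔ (U : Set X) ⊆ V.set := Heyting.Regular.toRegular_le

theorem closure_reg (U : Opens X) :
    closure (reg U).set = closure (U : Set X) := by
  refine subset_antisymm ?_ (closure_mono (subset_reg U))
  rw [set_reg]
  exact closure_minimal interior_subset isClosed_closure

theorem disjoint_iff {U V : RegOpens X} : Disjoint U V ↔ Disjoint U.set V.set := by
  rw [_root_.disjoint_iff, Set.disjoint_iff_inter_eq_empty, ← set_inf, ← set_bot,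
    set_injective.eq_iff]
  rfl

/-- The relation `cl U` is compact and contained in `V`. -/
def ll (U V : RegOpens X) : Prop := IsCompact (closure U.set) ∧ closure U.set ⊆ V.set

theorem ll_top {U : RegOpens X} : ll U ⊤ ↔ IsCompact (closure U.set) :=
  ⟨fun h => h.1, fun h => ⟨h, Set.subset_univ _⟩⟩

variable [LocallyCompactSpace X] [T2Space X]

/-- A compact set inside an open set has a regular open neighbourhood which is compact in it. -/
theorem exists_between {K V : Set X} (hK : IsCompact K) (hV : IsOpen V) (hKV : K ⊆ V) :
    ∃ W : RegOpens X, K ⊆ W.set ∧ IsCompact (closure W.set) ∧ closure W.set ⊆ V := by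
  obtain ⟨L, hL, hKL, hLV⟩ := exists_compact_between hK hV hKV
  refine ⟨reg ⟨interior L, isOpen_interior⟩,
    hKL.trans (subset_reg ⟨interior L, isOpen_interior⟩), ?_⟩
  have h : closure (interior L) ⊆ L := closure_minimal interior_subset hL.isClosed
  rw [closure_reg]
  exact ⟨hL.of_isClosed_subset isClosed_closure h, h.trans hLV⟩

theorem exists_nhd {x : X} {V : Set X} (hV : IsOpen V) (hx : x ∈ V) :
    ∃ W : RegOpens X, x ∈ W.set ∧ IsCompact (closure W.set) ∧ closure W.set ⊆ V := by
  simpa using exists_between (isCompact_singleton (x := x)) hV (by simpa using hx)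

theorem isMVD : IsMVD (ll (X := X)) where
  ll1 U V h := subset_closure.trans h.2
  ll2 := by simp [ll, set_bot]
  ll3 U V W T hUV hVW hWT :=
    ⟨hVW.1.of_isClosed_subset isClosed_closure (closure_mono hUV),
      (closure_mono hUV).trans (hVW.2.trans hWT)⟩
  ll4 U V W hU hV := by
    -- The join is the regularisation of the union, which has the same closure.
    have h : closure (U ⊔ V).set = closure U.set ∪ closure V.set := by
      rw [← closure_union]
      exact closure_reg (U.val ⊔ V.val)
    rw [ll, h]
    exact ⟨hU.1.union hV.1, Set.union_subset hU.2 hV.2⟩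
  ll5 U W h := by
    obtain ⟨V, h1, h2, h3⟩ := exists_between h.1 W.isOpen h.2
    exact ⟨V, ⟨h.1, h1⟩, h2, h3⟩
  ll6 U hU := by
    obtain ⟨x, hx⟩ : U.set.Nonempty := Set.nonempty_iff_ne_empty.2 fun h =>
      hU (set_injective h)
    obtain ⟨V, h1, h2, h3⟩ := exists_nhd U.isOpen hx
    refine ⟨V, ?_, h2, h3⟩
    rintro rfl
    exact h1
  ll4' U V W hV hW := ⟨hV.1, Set.subset_inter hV.2 hW.2⟩
  mvd U V hU h := by
    refine ⟨hU.1, ?_⟩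
    rw [← interior_closure V]
    have h2 := h.2
    rw [set_compl, set_compl, closure_compl, Set.compl_subset_compl] at h2
    exact h2

end RegOpens

/-- The complete MVD-algebra of regular open sets of a locally compact Hausdorff space. -/
def SLC.toIA (X : SLC.{u}) : IA.{u} where
  carrier := RegOpens X.carrier
  ll := RegOpens.ll
  isMVD := RegOpens.isMVD

/-! ### Skeletal maps and complete homomorphisms of regular open sets -/

section Skeletal

variable {X Y : Type*} [TopologicalSpace X] [TopologicalSpace Y]

/-- A dense `V` meets the non-empty open set `int cl f(U)`; being open, it then meets `f(U)` itself.
-/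
theorem IsSkeletal.dense_preimage {f : X → Y} (hf : IsSkeletal f) {V : Set Y}
    (hV : IsOpen V) (hd : Dense V) : Dense (f ⁻¹' V) := by
  rw [dense_iff_inter_open]
  intro U hU hne
  obtain ⟨y, hy, hyV⟩ := hd.inter_open_nonempty _ isOpen_interior (hf U hU hne)
  obtain ⟨_, hzV, x, hx, rfl⟩ := mem_closure_iff.1 (interior_subset hy) V hV hyV
  exact ⟨x, hx, hzV⟩

theorem Opens.dense_sup_compl (U : Opens X) : Dense ((U ⊔ Uᶜ : Opens X) : Set X) := by
  rw [Opens.coe_sup, RegOpens.coe_opens_compl]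
  intro x
  rw [closure_union]
  by_cases hx : x ∈ closure (U : Set X)
  · exact Or.inl hx
  · exact Or.inr (subset_closure hx)

theorem Opens.compl_eq_bot_of_dense {U : Opens X} (h : Dense (U : Set X)) : Uᶜ = ⊥ := by
  refine Opens.ext ?_
  rw [RegOpens.coe_opens_compl, h.closure_eq, Set.compl_univ, Opens.coe_bot]

/-- The preimages of `V` and `Vᶜ` are disjoint, and their union is dense as the preimage of the
dense open set `V ⊔ Vᶜ`. -/
theorem IsSkeletal.comap_compl {f : C(X, Y)} (hf : IsSkeletal f) (V : Opens Y) :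
    (Opens.comap f Vᶜ)ᶜᶜ = (Opens.comap f V)ᶜ := by
  refine le_antisymm (compl_le_compl ?_) ?_
  · rw [le_compl_iff_disjoint_right, disjoint_iff, ← map_inf, inf_compl_eq_bot, map_bot]
  · rw [le_compl_iff_disjoint_right, disjoint_iff, ← compl_sup, ← map_sup]
    exact Opens.compl_eq_bot_of_dense
      (hf.dense_preimage (V ⊔ Vᶜ).isOpen (Opens.dense_sup_compl V))

theorem IsSkeletal.reg_comap_compl {f : C(X, Y)} (hf : IsSkeletal f) (V : RegOpens Y) :
    RegOpens.reg (Opens.comap f Vᶜ.val) = (RegOpens.reg (Opens.comap f V.val))ᶜ :=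
  Heyting.Regular.coe_injective
    ((hf.comap_compl V.val).trans (compl_compl_compl _).symm)

/-- Regularising before pulling back is redundant; preservation of joins and functoriality both rest
on this. -/
theorem IsSkeletal.reg_comap_reg {f : C(X, Y)} (hf : IsSkeletal f) (V : Opens Y) :
    RegOpens.reg (Opens.comap f (RegOpens.reg V).val) = RegOpens.reg (Opens.comap f V) :=
  Heyting.Regular.coe_injective <|
    calc (Opens.comap f Vᶜᶜ)ᶜᶜ = (Opens.comap f Vᶜ)ᶜ := hf.comap_compl _
      _ = (Opens.comap f Vᶜ)ᶜᶜᶜ := (compl_compl_compl _).symm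
      _ = (Opens.comap f V)ᶜᶜ := by rw [hf.comap_compl]

theorem IsSkeletal.reg_comap_sSup {f : C(X, Y)} (hf : IsSkeletal f) (S : Set (RegOpens Y)) :
    RegOpens.reg (Opens.comap f (sSup S).val) =
      sSup ((fun V : RegOpens Y => RegOpens.reg (Opens.comap f V.val)) '' S) := by
  rw [Heyting.Regular.coe_sSup]
  refine (hf.reg_comap_reg _).trans (eq_of_forall_ge_iff fun c => ?_)
  rw [sSup_le_iff, Set.forall_mem_image]
  refine Heyting.Regular.toRegular_le.trans ?_
  rw [map_iSup₂, iSup₂_le_iff]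
  exact forall₂_congr fun V _ => Heyting.Regular.toRegular_le.symm

/-- The preimage homomorphism of a skeletal map. -/
def regPreimage (f : C(X, Y)) (hf : IsSkeletal f) :
    CompleteLatticeHom (RegOpens Y) (RegOpens X) where
  toFun V := RegOpens.reg (Opens.comap f V.val)
  map_sInf' S := by
    rw [← compl_inj_iff, ← hf.reg_comap_compl, compl_sInf', hf.reg_comap_sSup, compl_sInf',
      Set.image_image, Set.image_image]
    simp only [hf.reg_comap_compl]
  map_sSup' S := hf.reg_comap_sSup S

theorem preimage_subset_regPreimage (f : C(X, Y)) (hf : IsSkeletal f) (V : RegOpens Y) :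
    f ⁻¹' V.set ⊆ (regPreimage f hf V).set :=
  RegOpens.subset_reg (Opens.comap f V.val)

theorem regPreimage_le_iff (f : C(X, Y)) (hf : IsSkeletal f) {V : RegOpens Y} {U : RegOpens X} :
    regPreimage f hf V ≤ U ↔ f ⁻¹' V.set ⊆ U.set :=
  RegOpens.reg_le

theorem closure_regPreimage (f : C(X, Y)) (hf : IsSkeletal f) (V : RegOpens Y) :
    closure (regPreimage f hf V).set = closure (f ⁻¹' V.set) :=
  RegOpens.closure_reg (Opens.comap f V.val)

theorem closure_regPreimage_subset (f : C(X, Y)) (hf : IsSkeletal f) (V : RegOpens Y) :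
    closure (regPreimage f hf V).set ⊆ f ⁻¹' closure V.set := by
  rw [closure_regPreimage]
  exact f.continuous.closure_preimage_subset _

end Skeletal

/-- For a closed neighbourhood `K ⊆ U` of a point, closedness of `f` gives `cl f(int K) ⊆ f(K) ⊆
f(U)`. -/
theorem IsPerfectMap.isSkeletal_iff {X Y : Type*} [TopologicalSpace X] [TopologicalSpace Y]
    [RegularSpace X] {f : X → Y} (hf : IsPerfectMap f) : IsSkeletal f ↔ IsQuasiOpen f := by
  refine ⟨fun h => ⟨hf.continuous, fun U hU ⟨x, hx⟩ => ?_⟩, fun h U hU hne =>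
    (h.interior_nonempty U hU hne).mono (interior_mono subset_closure)⟩
  obtain ⟨K, hK, hKc, hKU⟩ := exists_mem_nhds_isClosed_subset (hU.mem_nhds hx)
  refine (h (interior K) isOpen_interior ⟨x, mem_interior_iff_mem_nhds.2 hK⟩).mono
    (interior_mono ?_)
  exact (closure_minimal (Set.image_mono interior_subset) (hf.isClosedMap K hKc)).trans
    (Set.image_mono hKU)

/-! ### The contravariant functor from `SLC` to `IA` -/

/-- The underlying continuous map of a morphism of `SLC`. -/
def SLC.Hom.toContinuousMap {X Y : SLC.{u}} (f : SLC.Hom X Y) : C(X.carrier, Y.carrier) :=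
  ⟨f.toFun, f.isPerfect.continuous⟩

theorem SLC.Hom.isIAMorphism {X Y : SLC.{u}} (f : SLC.Hom X Y) :
    IsIAMorphism Y.toIA X.toIA (regPreimage f.toContinuousMap f.isSkeletal) := by
  have hb (V : RegOpens Y.carrier) (hV : IsCompact (closure V.set)) :
      IsCompact (closure (regPreimage f.toContinuousMap f.isSkeletal V).set) :=
    (((isPerfectMap_iff _).1 f.isPerfect).isCompact_preimage hV).of_isClosed_subset
      isClosed_closure (closure_regPreimage_subset _ _ _)
  refine ⟨fun (U V : RegOpens Y.carrier) h => ⟨hb U h.1, ?_⟩, fun (U : RegOpens X.carrier) hU => ?_,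
    fun (V : RegOpens Y.carrier) hV => RegOpens.ll_top.2 (hb V hV.1)⟩
  · exact (closure_regPreimage_subset _ _ _).trans
      ((Set.preimage_mono h.2).trans (preimage_subset_regPreimage _ _ _))
  -- For (S2), a relatively compact `V ⊇ f(cl U)` satisfies `U ≤ φ(V)`, hence `φ_Λ(U) ≤ V`.
  · obtain ⟨V, hUV, hV, -⟩ := RegOpens.exists_between (hU.1.image f.isPerfect.continuous)
      isOpen_univ (Set.subset_univ _)
    refine Y.toIA.isMVD.mono (RegOpens.ll_top.2 hV) ((lowerAdj_gc _ _ _).2 ?_) le_rfl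
    exact RegOpens.le_iff.2 ((subset_closure.trans (Set.image_subset_iff.1 hUV)).trans
      (preimage_subset_regPreimage f.toContinuousMap f.isSkeletal V))

open CategoryTheory Opposite

/-- The contravariant functor assigning to a space the MVD-algebra of its regular open sets. -/
def slcToIA : SLC.{u}ᵒᵖ ⥤ IA.{u} where
  obj X := X.unop.toIA
  map f := ⟨regPreimage f.unop.toContinuousMap f.unop.isSkeletal, f.unop.isIAMorphism⟩
  map_id X := by
    refine IA.Hom.ext (CompleteLatticeHom.ext fun V => ?_)
    exact Heyting.Regular.toRegular_coe V
  map_comp f g := by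
    refine IA.Hom.ext (CompleteLatticeHom.ext fun V => ?_)
    exact (g.unop.isSkeletal.reg_comap_reg (f := g.unop.toContinuousMap)
      (Opens.comap f.unop.toContinuousMap V.val)).symm

/-! ### Full faithfulness -/

theorem CompleteLatticeHom.map_disjoint {A B : Type*} [CompleteLattice A] [CompleteLattice B]
    (φ : CompleteLatticeHom A B) {a b : A} (h : Disjoint a b) : Disjoint (φ a) (φ b) := by
  rw [disjoint_iff] at h ⊢
  rw [← map_inf, h, map_bot]

/-- Complete homomorphisms preserve disjointness of regular open sets. -/
theorem RegOpens.disjoint_map {X Y : Type*} [TopologicalSpace X] [TopologicalSpace Y]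
    (φ : CompleteLatticeHom (RegOpens Y) (RegOpens X)) {U V : RegOpens Y}
    (h : Disjoint U.set V.set) : Disjoint (φ U).set (φ V).set :=
  RegOpens.disjoint_iff.1 (φ.map_disjoint (RegOpens.disjoint_iff.2 h))

/-- If `f x ≠ g x`, the common homomorphism would send disjoint regular neighbourhoods of these
points to two sets containing `x`. -/
theorem SLC.Hom.eq_of_regPreimage_eq {X Y : SLC.{u}} {f g : SLC.Hom X Y}
    (h : regPreimage f.toContinuousMap f.isSkeletal = regPreimage g.toContinuousMap g.isSkeletal) :
    f = g := by
  refine SLC.Hom.ext (funext fun x => ?_)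
  by_contra hne
  obtain ⟨U, V, hU, hV, hxU, hxV, hUV⟩ := t2_separation hne
  obtain ⟨U', hxU', -, hUU'⟩ := RegOpens.exists_nhd hU hxU
  obtain ⟨V', hxV', -, hVV'⟩ := RegOpens.exists_nhd hV hxV
  have hd : Disjoint U'.set V'.set :=
    hUV.mono (subset_closure.trans hUU') (subset_closure.trans hVV')
  have h1 : x ∈ (regPreimage g.toContinuousMap g.isSkeletal U').set := by
    rw [← h]; exact preimage_subset_regPreimage _ _ _ hxU'
  have h2 : x ∈ (regPreimage g.toContinuousMap g.isSkeletal V').set :=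
    preimage_subset_regPreimage _ _ _ hxV'
  exact Set.disjoint_left.1 (RegOpens.disjoint_map _ hd) h1 h2

/-! ### The skeletal perfect map dual to a morphism of `IA` -/

section Dual

variable {X Y : SLC.{u}} {φ : CompleteLatticeHom (RegOpens Y.carrier) (RegOpens X.carrier)}

/-- Otherwise every `y` has neighbourhoods `W y ≪ V y` with `x ∉ φ (V y)`. For a relatively compact
`U ∋ x`, (S2) lets finitely many `W y` cover `φ_Λ U`, so `x` lies in some `cl φ (W y)`, which (ES1)
puts inside `φ (V y)`. -/
theorem IsIAMorphism.exists_dual_point (hφ : IsIAMorphism Y.toIA X.toIA φ) (x : X.carrier) :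
    ∃ y : Y.carrier, ∀ V : RegOpens Y.carrier, y ∈ V.set → x ∈ (φ V).set := by
  by_contra! hcon
  choose V hyV hxV using hcon
  choose W hyW hWc hWV using fun y => RegOpens.exists_nhd (V y).isOpen (hyV y)
  obtain ⟨U, hxU, hUc, -⟩ := RegOpens.exists_nhd isOpen_univ (Set.mem_univ x)
  have hb : IsCompact (closure (lowerAdj φ U).set) :=
    RegOpens.ll_top.1 (hφ.s2 U (RegOpens.ll_top.2 hUc))
  obtain ⟨t, ht⟩ := hb.elim_finite_subcover (fun y => (W y).set) (fun y => (W y).isOpen)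
    fun y _ => Set.mem_iUnion.2 ⟨y, hyW y⟩
  -- A finite join may exceed the union, but it stays inside any closed set containing that union.
  have key : ∀ t : Finset Y.carrier, (φ (t.sup W)).set ⊆ ⋃ y ∈ t, closure (φ (W y)).set := by
    intro t
    have : φ (t.sup W) ≤ RegOpens.reg ⟨interior (⋃ y ∈ t, closure (φ (W y)).set),
        isOpen_interior⟩ := by
      rw [map_finset_sup]
      refine Finset.sup_le fun y hy => ?_
      refine RegOpens.le_iff.2 (subset_trans ?_ (RegOpens.subset_reg _))
      refine interior_maximal ?_ (φ (W y)).isOpen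
      exact subset_closure.trans
        (Set.subset_biUnion_of_mem (u := fun y => closure (φ (W y)).set) hy)
    refine (RegOpens.le_iff.1 this).trans ?_
    rw [RegOpens.set_reg]
    refine interior_subset.trans (closure_minimal interior_subset ?_)
    exact t.finite_toSet.isClosed_biUnion fun _ _ => isClosed_closure
  have hle : lowerAdj φ U ≤ t.sup W := by
    refine RegOpens.le_iff.2 (subset_closure.trans (ht.trans ?_))
    exact Set.iUnion₂_subset fun y hy => RegOpens.le_iff.1 (Finset.le_sup (f := W) hy)
  have hx := key t (RegOpens.le_iff.1 ((lowerAdj_gc φ _ _).1 hle) hxU)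
  obtain ⟨y, -, hy⟩ := Set.mem_iUnion₂.1 hx
  exact hxV y ((hφ.es1 (W y) (V y) ⟨hWc y, hWV y⟩).2 hy)

/-- The point map dual to a morphism of `IA`. -/
noncomputable def IsIAMorphism.dualMap (hφ : IsIAMorphism Y.toIA X.toIA φ) (x : X.carrier) :
    Y.carrier := (hφ.exists_dual_point x).choose

theorem IsIAMorphism.preimage_dualMap_subset (hφ : IsIAMorphism Y.toIA X.toIA φ)
    (V : RegOpens Y.carrier) : hφ.dualMap ⁻¹' V.set ⊆ (φ V).set := fun x hx =>
  (hφ.exists_dual_point x).choose_spec V hx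

/-- If `f x ∉ cl V` then `f x ∈ V*`, so `x ∈ φ(V*)`, which is disjoint from `φ(V)`. -/
theorem IsIAMorphism.subset_preimage_dualMap (hφ : IsIAMorphism Y.toIA X.toIA φ)
    (V : RegOpens Y.carrier) : (φ V).set ⊆ hφ.dualMap ⁻¹' closure V.set := by
  intro x hx
  by_contra hy
  have hy' : hφ.dualMap x ∈ Vᶜ.set := by rw [RegOpens.set_compl]; exact hy
  have hd : Disjoint V.set Vᶜ.set := RegOpens.disjoint_iff.1 disjoint_compl_right
  exact Set.disjoint_left.1 (RegOpens.disjoint_map φ hd) hx (hφ.preimage_dualMap_subset _ hy')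

theorem IsIAMorphism.continuous_dualMap (hφ : IsIAMorphism Y.toIA X.toIA φ) :
    Continuous hφ.dualMap := by
  refine continuous_iff_continuousAt.2 fun x => ?_
  rw [ContinuousAt, Filter.tendsto_def]
  intro N hN
  obtain ⟨V, hVN, hV, hxV⟩ := mem_nhds_iff.1 hN
  obtain ⟨W, hxW, -, hWV⟩ := RegOpens.exists_nhd hV hxV
  exact Filter.mem_of_superset ((φ W).isOpen.mem_nhds (hφ.preimage_dualMap_subset W hxW))
    ((hφ.subset_preimage_dualMap W).trans (Set.preimage_mono (hWV.trans hVN)))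

theorem IsIAMorphism.isPerfectMap_dualMap (hφ : IsIAMorphism Y.toIA X.toIA φ) :
    IsPerfectMap hφ.dualMap := by
  rw [isPerfectMap_iff, isProperMap_iff_isCompact_preimage]
  refine ⟨hφ.continuous_dualMap, fun K hK => ?_⟩
  obtain ⟨V, hKV, hVc, -⟩ := RegOpens.exists_between hK isOpen_univ (Set.subset_univ _)
  have hb : IsCompact (closure (φ V).set) := RegOpens.ll_top.1 (hφ.s3 V (RegOpens.ll_top.2 hVc))
  exact hb.of_isClosed_subset (hK.isClosed.preimage hφ.continuous_dualMap)
    ((Set.preimage_mono hKV).trans ((hφ.preimage_dualMap_subset V).trans subset_closure))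

/-- The regularisation of `V` lies below the join of the `W` with `cl W ⊆ V`. Since `φ` preserves
that join and `φ(W) ⊆ f⁻¹(cl W) ⊆ f⁻¹(V)`, the bound follows. -/
theorem IsIAMorphism.subset_closure_preimage_dualMap (hφ : IsIAMorphism Y.toIA X.toIA φ)
    (V : Opens Y.carrier) :
    (φ (RegOpens.reg V)).set ⊆ closure (hφ.dualMap ⁻¹' V) := by
  let S : Set (RegOpens Y.carrier) := {W | closure W.set ⊆ V}
  have hS : RegOpens.reg V ≤ sSup S := RegOpens.reg_le.2 fun y hy => by
    obtain ⟨W, hyW, -, hWV⟩ := RegOpens.exists_nhd V.isOpen hy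
    exact RegOpens.le_iff.1 (le_sSup (show W ∈ S from hWV)) hyW
  let U : RegOpens X.carrier := RegOpens.reg (Opens.comap ⟨_, hφ.continuous_dualMap⟩ V)
  have hU : φ (sSup S) ≤ U := by
    rw [map_sSup, sSup_le_iff, Set.forall_mem_image]
    intro W hW
    exact RegOpens.le_iff.2 (((hφ.subset_preimage_dualMap W).trans (Set.preimage_mono hW)).trans
      (RegOpens.subset_reg (Opens.comap ⟨_, hφ.continuous_dualMap⟩ V)))
  refine (RegOpens.le_iff.1 ((OrderHomClass.mono φ hS).trans hU)).trans ?_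
  rw [RegOpens.set_reg]
  exact interior_subset

/-- If `int cl f(U)` were empty, the complement of `cl f(U)` would be dense and so regularise to
`⊤`; its preimage would be dense, yet it misses `U`. -/
theorem IsIAMorphism.isSkeletal_dualMap (hφ : IsIAMorphism Y.toIA X.toIA φ) :
    IsSkeletal hφ.dualMap := by
  intro U hU hne
  by_contra hemp
  rw [Set.not_nonempty_iff_eq_empty] at hemp
  let V : Opens Y.carrier := ⟨(closure (hφ.dualMap '' U))ᶜ, isClosed_closure.isOpen_compl⟩
  have hV : RegOpens.reg V = ⊤ := by
    refine RegOpens.set_injective ?_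
    rw [RegOpens.set_reg, RegOpens.set_top]
    change interior (closure (closure _)ᶜ) = _
    rw [closure_compl, hemp, Set.compl_empty, interior_univ]
  have h := hφ.subset_closure_preimage_dualMap V
  rw [hV, map_top] at h
  obtain ⟨x, hx⟩ := hne
  obtain ⟨z, hzU, hz⟩ := mem_closure_iff.1 (h (Set.mem_univ x)) U hU hx
  exact hz (subset_closure (Set.mem_image_of_mem _ hzU))

/-- The skeletal perfect map dual to a morphism of `IA`. -/
noncomputable def IsIAMorphism.dual (hφ : IsIAMorphism Y.toIA X.toIA φ) : SLC.Hom X Y where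
  toFun := hφ.dualMap
  isPerfect := hφ.isPerfectMap_dualMap
  isSkeletal := hφ.isSkeletal_dualMap

theorem IsIAMorphism.regPreimage_dual (hφ : IsIAMorphism Y.toIA X.toIA φ) :
    regPreimage hφ.dual.toContinuousMap hφ.dual.isSkeletal = φ := by
  refine CompleteLatticeHom.ext fun V => le_antisymm ?_ ?_
  · exact (regPreimage_le_iff _ _).2 (hφ.preimage_dualMap_subset V)
  · have h := hφ.subset_closure_preimage_dualMap V.val
    rw [show RegOpens.reg V.val = V from Heyting.Regular.toRegular_coe V] at h
    have hset : (regPreimage hφ.dual.toContinuousMap hφ.dual.isSkeletal V).set =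
        interior (closure (hφ.dualMap ⁻¹' V.set)) := RegOpens.set_reg _
    rw [RegOpens.le_iff, hset]
    exact interior_maximal h (φ V).isOpen

end Dual

instance slcToIA_faithful : slcToIA.{u}.Faithful where
  map_injective h := Quiver.Hom.unop_inj (SLC.Hom.eq_of_regPreimage_eq (congrArg IA.Hom.toHom h))

instance slcToIA_full : slcToIA.{u}.Full where
  map_surjective ψ :=
    ⟨Quiver.Hom.op ψ.prop.dual, IA.Hom.ext ψ.prop.regPreimage_dual⟩

/-! ### The space of points of a complete MVD-algebra -/

/-- A point of an MVD-algebra: a proper round filter which decides every pair `a ≪ b`. -/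
@[ext]
structure MVDPoint {B : Type*} [BooleanAlgebra B] (ll : B → B → Prop) where
  /-- the elements of the algebra containing the point -/
  mem : Set B
  bot_notMem : ⊥ ∉ mem
  mem_of_le : ∀ a b, a ≤ b → a ∈ mem → b ∈ mem
  inf_mem : ∀ a b, a ∈ mem → b ∈ mem → a ⊓ b ∈ mem
  round : ∀ a ∈ mem, ∃ b ∈ mem, ll b a
  decide : ∀ a b, ll a b → aᶜ ∈ mem ∨ b ∈ mem

namespace MVDPoint

section BooleanAlgebra

variable {B : Type*} [BooleanAlgebra B] {ll : B → B → Prop}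

/-- The set of points contained in `a`. -/
def basic (ll : B → B → Prop) (a : B) : Set (MVDPoint ll) := {F | a ∈ F.mem}

theorem basic_mono {a b : B} (h : a ≤ b) : basic ll a ⊆ basic ll b := fun F => F.mem_of_le a b h

theorem basic_inf (a b : B) : basic ll (a ⊓ b) = basic ll a ∩ basic ll b :=
  Set.ext fun F => ⟨fun h => ⟨F.mem_of_le _ _ inf_le_left h, F.mem_of_le _ _ inf_le_right h⟩,
    fun h => F.inf_mem _ _ h.1 h.2⟩

theorem basic_bot : basic ll ⊥ = ∅ := Set.eq_empty_of_forall_notMem fun F => F.bot_notMem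

theorem disjoint_basic {a b : B} (h : Disjoint a b) : Disjoint (basic ll a) (basic ll b) := by
  rw [Set.disjoint_iff_inter_eq_empty, ← basic_inf, disjoint_iff.1 h, basic_bot]

theorem top_mem (h : IsMVD ll) (F : MVDPoint ll) : ⊤ ∈ F.mem :=
  (F.decide _ _ h.ll2).elim (F.mem_of_le _ _ le_top) (F.mem_of_le _ _ le_top)

/-- The filter of elements strongly containing a member of an ultrafilter. -/
def ofPrime (h : IsMVD ll) (u : Set B) (hbot : ⊥ ∉ u)
    (hinf : ∀ a b, a ∈ u → b ∈ u → a ⊓ b ∈ u) (hdec : ∀ a b, ll a b → b ∈ u ∨ aᶜ ∈ u)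
    (d : B) (hd : d ∈ u) (hdb : ll d ⊤) : MVDPoint ll where
  mem := {a | ∃ b ∈ u, ll b a}
  bot_notMem := by
    rintro ⟨b, hb, hb0⟩
    exact hbot (le_bot_iff.1 (h.ll1 _ _ hb0) ▸ hb)
  mem_of_le := by
    rintro a b hab ⟨c, hc, hca⟩
    exact ⟨c, hc, h.mono hca le_rfl hab⟩
  inf_mem := by
    rintro a b ⟨c, hc, hca⟩ ⟨d, hd, hdb⟩
    exact ⟨c ⊓ d, hinf _ _ hc hd, h.inf_ll_inf hca hdb⟩
  round := by
    rintro a ⟨c, hc, hca⟩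
    obtain ⟨b, hcb, hba⟩ := h.ll5 _ _ hca
    exact ⟨b, ⟨c, hc, hcb⟩, hba⟩
  decide := by
    intro a b hab
    obtain ⟨c, hac, hcb⟩ := h.ll5 _ _ hab
    obtain ⟨e, hce, heb⟩ := h.ll5 _ _ hcb
    rcases hdec _ _ hce with he | hc
    · exact Or.inr ⟨e, he, heb⟩
    -- Only bounded elements can stand to the left of `≪`, so `cᶜ` is first cut down by the bounded
    -- member `d`.
    · exact Or.inl ⟨d ⊓ cᶜ, hinf _ _ hd hc,
        h.ll_compl hac (h.mono hdb inf_le_left le_rfl) inf_le_right⟩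

/-- Take a nonzero `b ≪ a` and a prime ideal avoiding `b`; its complement is a prime filter with the
bounded member `b`. -/
theorem exists_mem (h : IsMVD ll) {a : B} (ha : a ≠ ⊥) : ∃ F : MVDPoint ll, a ∈ F.mem := by
  obtain ⟨b, hb, hba⟩ := h.ll6 a ha
  have hdis : Disjoint (Order.PFilter.principal b : Set B)
      (Order.Ideal.principal ⊥ : Order.Ideal B) := by
    rw [Set.disjoint_left]
    intro c hc hc'
    exact hb (le_bot_iff.1 ((Order.PFilter.mem_principal.1 hc).trans
      (Order.Ideal.mem_principal.1 hc')))
  obtain ⟨J, hJ, -, hbJ⟩ := DistribLattice.prime_ideal_of_disjoint_filter_ideal hdis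
  have hbu : b ∉ J := Set.disjoint_left.1 hbJ (Order.PFilter.mem_principal.2 le_rfl)
  refine ⟨ofPrime h {c | c ∉ J} (fun hn => hn J.bot_mem)
    (fun c d hc hd hcd => (hJ.mem_or_mem hcd).elim hc hd) (fun c d hcd => ?_) b hbu
    (h.bounded hba), b, hbu, hba⟩
  by_contra! hn
  simp only [Set.mem_ofPred_eq, not_not] at hn
  refine hbu (J.lower ?_ (J.sup_mem hn.1 hn.2))
  exact le_top.trans (sup_compl_eq_top.ge.trans (sup_le_sup_right (h.ll1 _ _ hcd) cᶜ))

theorem basic_subset_iff (h : IsMVD ll) {a b : B} : basic ll a ⊆ basic ll b ↔ a ≤ b := by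
  refine ⟨fun hab => ?_, basic_mono⟩
  by_contra hn
  have hne : a ⊓ bᶜ ≠ ⊥ := fun h0 => hn (by
    rw [← compl_compl b]; exact le_compl_iff_disjoint_right.2 (disjoint_iff.2 h0))
  obtain ⟨F, hF⟩ := exists_mem h hne
  exact Set.disjoint_left.1 (disjoint_basic (disjoint_compl_right (a := b)))
    (hab (basic_mono inf_le_left hF)) (basic_mono inf_le_right hF)

instance : TopologicalSpace (MVDPoint ll) :=
  TopologicalSpace.generateFrom (Set.range (basic ll))

theorem isOpen_basic (a : B) : IsOpen (basic ll a) :=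
  TopologicalSpace.isOpen_generateFrom_of_mem ⟨a, rfl⟩

theorem isTopologicalBasis (h : IsMVD ll) : IsTopologicalBasis (Set.range (basic ll)) where
  exists_subset_inter := by
    rintro _ ⟨a, rfl⟩ _ ⟨b, rfl⟩ F hF
    exact ⟨_, ⟨a ⊓ b, rfl⟩, by rwa [basic_inf], (basic_inf a b).subset⟩
  sUnion_eq := Set.eq_univ_of_forall fun F => ⟨_, ⟨⊤, rfl⟩, top_mem h F⟩
  eq_generateFrom := rfl

theorem exists_basic_subset (h : IsMVD ll) {F : MVDPoint ll} {U : Set (MVDPoint ll)}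
    (hU : IsOpen U) (hF : F ∈ U) : ∃ a ∈ F.mem, basic ll a ⊆ U := by
  obtain ⟨_, ⟨a, rfl⟩, ha, haU⟩ := (isTopologicalBasis h).exists_subset_of_mem_open hF hU
  exact ⟨a, ha, haU⟩

/-- If `a ∈ F \ G`, roundness gives `b ≪ a` in `F`, and `G`, deciding this pair without containing
`a`, contains `bᶜ`. -/
theorem t2Space : T2Space (MVDPoint ll) := by
  have key (F G : MVDPoint ll) (hFG : ¬ F.mem ⊆ G.mem) :
      ∃ a, a ∈ F.mem ∧ aᶜ ∈ G.mem := by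
    obtain ⟨a, haF, haG⟩ := Set.not_subset.1 hFG
    obtain ⟨b, hb, hba⟩ := F.round a haF
    exact ⟨b, hb, (G.decide _ _ hba).resolve_right haG⟩
  refine ⟨fun F G hne => ?_⟩
  by_cases hFG : F.mem ⊆ G.mem
  · have hGF : ¬ G.mem ⊆ F.mem := fun h' => hne (MVDPoint.ext (hFG.antisymm h'))
    obtain ⟨a, haG, haF⟩ := key G F hGF
    exact ⟨_, _, isOpen_basic _, isOpen_basic _, haF, haG, disjoint_basic disjoint_compl_left⟩
  · obtain ⟨a, haF, haG⟩ := key F G hFG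
    exact ⟨_, _, isOpen_basic _, isOpen_basic _, haF, haG, disjoint_basic disjoint_compl_right⟩

theorem closure_basic (h : IsMVD ll) (a : B) : closure (basic ll a) = (basic ll aᶜ)ᶜ := by
  refine subset_antisymm (closure_minimal ?_ (isOpen_basic _).isClosed_compl) fun F hF => ?_
  · exact Set.disjoint_left.1 (disjoint_basic disjoint_compl_right)
  · rw [mem_closure_iff]
    intro U hU hFU
    obtain ⟨b, hb, hbU⟩ := exists_basic_subset h hU hFU
    by_contra hn
    -- A nonzero `b ⊓ a` would contain a point, so a basic neighbourhood missing `a` forces `b ≤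
    -- aᶜ`.
    refine hF (F.mem_of_le b _ ?_ hb)
    rw [le_compl_iff_disjoint_right, disjoint_iff]
    by_contra hne
    obtain ⟨G, hG⟩ := exists_mem h hne
    exact hn ⟨G, hbU (basic_mono inf_le_left hG), basic_mono inf_le_right hG⟩

theorem closure_basic_subset (h : IsMVD ll) {a b : B} (hab : ll a b) :
    closure (basic ll a) ⊆ basic ll b := by
  rw [closure_basic h]
  exact fun F hF => (F.decide _ _ hab).resolve_left hF

theorem isCompact_closure_basic (h : IsMVD ll) {a : B} (ha : ll a ⊤) :
    IsCompact (closure (basic ll a)) := by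
  obtain ⟨d, had, hd⟩ := h.ll5 _ _ ha
  rw [isCompact_iff_ultrafilter_le_nhds]
  intro 𝒰 h𝒰
  have h𝒰a : closure (basic ll a) ∈ 𝒰 := Filter.le_principal_iff.1 h𝒰
  -- The trace of `𝒰` on basic sets need not be a prime filter of `B`, but it decides all pairs `b ≪
  -- c`, because `basic bᶜ` and `basic c` cover the space. It contains the bounded element `d`
  -- because `cl (basic a) ⊆ basic d`.
  let G : MVDPoint ll := ofPrime h {c | basic ll c ∈ 𝒰}
    (fun h0 => 𝒰.empty_notMem (by rwa [Set.mem_ofPred_eq, basic_bot] at h0))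
    (fun b c hb hc => by
      rw [Set.mem_ofPred_eq, basic_inf]
      exact Filter.inter_mem hb hc)
    (fun b c hbc => by
      refine Ultrafilter.union_mem_iff.1 (Filter.mem_of_superset Filter.univ_mem fun F _ => ?_)
      exact (F.decide _ _ hbc).symm)
    d (Filter.mem_of_superset h𝒰a (closure_basic_subset h had)) hd
  have hG : (𝒰 : Filter (MVDPoint ll)) ≤ 𝓝 G := fun N hN => by
    obtain ⟨U, hUN, hU, hGU⟩ := mem_nhds_iff.1 hN
    obtain ⟨b, ⟨c, hc, hcb⟩, hbU⟩ := exists_basic_subset h hU hGU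
    exact Filter.mem_of_superset hc ((basic_mono (h.ll1 _ _ hcb)).trans (hbU.trans hUN))
  refine ⟨G, ?_, hG⟩
  exact isClosed_closure.mem_of_frequently_of_tendsto
    (Filter.Eventually.frequently h𝒰a) (f := id) hG

theorem locallyCompactSpace (h : IsMVD ll) : LocallyCompactSpace (MVDPoint ll) := by
  refine ⟨fun F N hN => ?_⟩
  obtain ⟨U, hUN, hU, hFU⟩ := mem_nhds_iff.1 hN
  obtain ⟨b, hb, hbU⟩ := exists_basic_subset h hU hFU
  obtain ⟨c, hc, hcb⟩ := F.round b hb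
  exact ⟨_, Filter.mem_of_superset ((isOpen_basic c).mem_nhds hc) subset_closure,
    (closure_basic_subset h hcb).trans (hbU.trans hUN),
    isCompact_closure_basic h (h.bounded hcb)⟩

/-- For the converse, roundness covers `cl (basic a)` by the `basic c` with `c ≪ b`; this family is
directed, so compactness yields a single `c` with `a ≤ c ≪ b`. -/
theorem ll_iff (h : IsMVD ll) {a b : B} :
    ll a b ↔ IsCompact (closure (basic ll a)) ∧ closure (basic ll a) ⊆ basic ll b := by
  refine ⟨fun hab => ⟨isCompact_closure_basic h (h.bounded hab), closure_basic_subset h hab⟩, ?_⟩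
  rintro ⟨hc, hab⟩
  have : Nonempty {c // ll c b} := ⟨⟨⊥, h.bot_ll b⟩⟩
  obtain ⟨⟨c, hcb⟩, hac⟩ := hc.elim_directed_cover (fun c : {c // ll c b} => basic ll c.1)
    (fun c => isOpen_basic _)
    (fun F hF => by
      obtain ⟨c, hc, hcb⟩ := F.round b (hab hF)
      exact Set.mem_iUnion.2 ⟨⟨c, hcb⟩, hc⟩)
    (fun c d => ⟨⟨c.1 ⊔ d.1, h.ll4 _ _ _ c.2 d.2⟩, basic_mono le_sup_left,
      basic_mono le_sup_right⟩)
  exact h.mono hcb ((basic_subset_iff h).1 (subset_closure.trans hac)) le_rfl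

end BooleanAlgebra

/-! ### Regular open sets of the space of points -/

variable {B : Type*} [CompleteBooleanAlgebra B] {ll : B → B → Prop}

/-- The regular open set of points contained in `a`. -/
def regBasic (h : IsMVD ll) (a : B) : RegOpens (MVDPoint ll) :=
  ⟨⟨basic ll a, isOpen_basic a⟩, Opens.ext (by
    rw [RegOpens.coe_opens_compl, RegOpens.coe_opens_compl]
    change (closure (closure (basic ll a))ᶜ)ᶜ = basic ll a
    rw [closure_basic h, compl_compl, closure_basic h, compl_compl, compl_compl])⟩

theorem set_regBasic (h : IsMVD ll) (a : B) : (regBasic h a).set = basic ll a := rfl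

/-- Completeness enters here: `b` is disjoint from every `a` with `basic a ⊆ U` iff it is disjoint
from their join. -/
theorem compl_closure_eq_basic (h : IsMVD ll) {U : Set (MVDPoint ll)} (hU : IsOpen U) :
    (closure U)ᶜ = basic ll (sSup {a | basic ll a ⊆ U})ᶜ := by
  refine subset_antisymm (fun F hF => ?_) ?_
  · obtain ⟨b, hb, hbU⟩ := exists_basic_subset h isClosed_closure.isOpen_compl hF
    refine F.mem_of_le b _ ?_ hb
    rw [le_compl_iff_disjoint_right, disjoint_sSup_iff]
    intro a ha
    rw [disjoint_iff]
    by_contra hne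
    obtain ⟨G, hG⟩ := exists_mem h hne
    exact hbU (basic_mono inf_le_left hG) (subset_closure (ha (basic_mono inf_le_right hG)))
  · rw [Set.subset_compl_comm, ← compl_compl (sSup _), ← closure_basic h, compl_compl]
    refine closure_mono fun F hF => ?_
    obtain ⟨a, ha, haU⟩ := exists_basic_subset h hU hF
    exact F.mem_of_le a _ (le_sSup haU) ha

theorem regBasic_surjective (h : IsMVD ll) : Function.Surjective (regBasic h) := fun U => by
  refine ⟨sSup {a | basic ll a ⊆ U.set}, compl_injective (RegOpens.set_injective ?_)⟩
  rw [RegOpens.set_compl, RegOpens.set_compl, compl_closure_eq_basic h U.isOpen, set_regBasic,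
    closure_basic h, compl_compl]

/-- A complete MVD-algebra is isomorphic to the regular open sets of its space of points. -/
noncomputable def regBasicIso (h : IsMVD ll) : B ≃o RegOpens (MVDPoint ll) where
  toEquiv := Equiv.ofBijective (regBasic h)
    ⟨fun _ _ hab => le_antisymm
      ((basic_subset_iff h).1 (congrArg RegOpens.set hab).subset)
      ((basic_subset_iff h).1 (congrArg RegOpens.set hab).superset), regBasic_surjective h⟩
  map_rel_iff' := basic_subset_iff h

theorem ll_regBasicIso (h : IsMVD ll) {a b : B} :
    RegOpens.ll (regBasicIso h a) (regBasicIso h b) ↔ ll a b := (ll_iff h).symm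

end MVDPoint

/-! ### Essential surjectivity and the main theorem -/

/-- The locally compact Hausdorff space of points of a complete MVD-algebra. -/
def IA.toSLC (X : IA.{u}) : SLC.{u} where
  carrier := MVDPoint X.ll
  locallyCompact := MVDPoint.locallyCompactSpace X.isMVD
  t2 := MVDPoint.t2Space

open CompleteLatticeHom.OrderIso in
theorem isIAMorphism_of_orderIso {X Y : IA.{u}} (e : X.carrier ≃o Y.carrier)
    (he : ∀ a b, Y.ll (e a) (e b) ↔ X.ll a b) :
    IsIAMorphism X Y (toCompleteLatticeHom e) where
  es1 a b := (he a b).2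
  s2 b hb := by
    have hl : lowerAdj (toCompleteLatticeHom e) b = e.symm b := eq_of_forall_ge_iff fun a =>
      (lowerAdj_gc (toCompleteLatticeHom e) b a).trans
        (e.symm_apply_le (x := a) (y := b)).symm
    rw [hl, ← he, e.apply_symm_apply, e.map_top]
    exact hb
  s3 a ha := by
    have h := (he a ⊤).2 ha
    rwa [e.map_top] at h

open CompleteLatticeHom.OrderIso in
/-- An order isomorphism preserving and reflecting `≪` is an isomorphism of `IA`. -/
def IA.isoOfOrderIso {X Y : IA.{u}} (e : X.carrier ≃o Y.carrier)
    (he : ∀ a b, Y.ll (e a) (e b) ↔ X.ll a b) : X ≅ Y where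
  hom := ⟨toCompleteLatticeHom e, isIAMorphism_of_orderIso e he⟩
  inv := ⟨toCompleteLatticeHom e.symm, isIAMorphism_of_orderIso e.symm fun a b => by
    rw [← he, e.apply_symm_apply, e.apply_symm_apply]⟩
  hom_inv_id := IA.Hom.ext (CompleteLatticeHom.ext e.symm_apply_apply)
  inv_hom_id := IA.Hom.ext (CompleteLatticeHom.ext e.apply_symm_apply)

instance slcToIA_essSurj : slcToIA.{u}.EssSurj where
  mem_essImage X := ⟨op X.toSLC, ⟨(IA.isoOfOrderIso (Y := X.toSLC.toIA)
    (MVDPoint.regBasicIso X.isMVD) fun _ _ => MVDPoint.ll_regBasicIso X.isMVD).symm⟩⟩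

/-- The categories `SAL` and `IA` are isomorphic, `SLC` and `IA` are dually equivalent, and the
morphisms of `SLC` are precisely the quasi-open perfect maps. -/
theorem mainTheorem3 :
    (∃ (K : CategoryTheory.Functor SAL.{u} IA.{u}) (T : CategoryTheory.Functor IA.{u} SAL.{u}),
      K.comp T = CategoryTheory.Functor.id SAL.{u} ∧
      T.comp K = CategoryTheory.Functor.id IA.{u}) ∧
    Nonempty (CategoryTheory.Equivalence (Opposite SLC.{u}) IA.{u}) ∧
    (∀ (X Y : SLC.{u}) (f : X.carrier → Y.carrier), IsPerfectMap f →
      (IsSkeletal f ↔ IsQuasiOpen f)) := by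
  have : slcToIA.{u}.IsEquivalence := {}
  exact ⟨⟨salToIA, iaToSAL, salToIA_comp_iaToSAL, iaToSAL_comp_salToIA⟩,
    ⟨slcToIA.asEquivalence⟩, fun _ _ _ hf => hf.isSkeletal_iff⟩
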